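/- Let $(A,[\cdot,\cdot],\rho)$ be a Lie algebroid over a smooth manifold $M$, let $d$ be its differential on $\Gamma(\bigwedge^\bullet A^*)$, let $\pi\in\Gamma(\bigwedge^2A)$ be a Poisson bivector, i.e. $[\pi,\pi]_{SN}=0$ for the Schouten–Nijenhuis bracket, and let $\omega\in\Gamma(\bigwedge^2A^*)$ be an arbitrary $2$-form. Put $\pi^\sharp(\alpha)=\pi(\alpha,\cdot)$, $\omega^\flat(X)=\omega(X,\cdot)$, $N=\pi^\sharp\circ\omega^\flat$ and $\omega_N=\omega(N\cdot,\cdot)$. For a $3$-form $H$, let $[\cdot,\cdot]$ denote the Dorfman bracket on $\Gamma(A\oplus A^*)$ of the structure $\mu+H$, where $\mu$ is the Lie algebroid structure of $A$; explicitly $$[X+\alpha,Y+\beta]=[X,Y]+\mathcal L_X\beta-i_Yd\alpha-H(X,Y,\cdot),$$ and let $\langle X+\alpha,Y+\beta\rangle=\beta(X)+\alpha(Y)$. When $dH=0$, so that $\mu+H$ is a Courant algebroid structure, a $C^\infty(M)$-linear endomorphism $J$ of $\Gamma(A\oplus A^*)$ is called a subtangent structure on $(A\oplus A^*,\mu+H)$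 (a c.p.s. structure with $\lambda=0$) if it is orthogonal, $\langle J\mathcal X,\mathcal Y\rangle+\langle\mathcal X,J\mathcal Y\rangle=0$, satisfies $J^2=0$, and has vanishing Nijenhuis torsion, $$T_J(\mathcal X,\mathcal Y)=[J\mathcal X,J\mathcal Y]-J\bigl([J\mathcal X,\mathcal Y]+[\mathcal X,J\mathcal Y]-J[\mathcal X,\mathcal Y]\bigr)=0 .$$ **Proposition.** The $3$-form $H=-d\omega$ is closed, and $$J=\begin{pmatrix}N&\pi^\sharp\\-\omega_N^\flat&-{}^tN\end{pmatrix},\qquad J(X+\alpha)=\bigl(NX+\pi^\sharp\alpha\bigr)+\bigl(-\omega_N^\flat X-{}^tN\alpha\bigr),$$ is a subtangent structure on $(A\oplus A^*,\mu-d\omega)$. -/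

import Mathlib

open scoped Manifold ContDiff

noncomputable section

/-! ## Lie algebroids over a smooth manifold -/

section Geometric

variable (E : Type*) [NormedAddCommGroup E] [NormedSpace ℝ E]
  {M : Type*} [TopologicalSpace M] [ChartedSpace E M] [IsManifold 𝓘(ℝ, E) ∞ M]
  (F : Type*) [NormedAddCommGroup F] [NormedSpace ℝ F]
  (V : M → Type*) [TopologicalSpace (Bundle.TotalSpace F V)]
  [∀ x, TopologicalSpace (V x)] [∀ x, AddCommGroup (V x)] [∀ x, Module ℝ (V x)]
  [FiberBundle F V] [VectorBundle ℝ F V]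

/-- A vector bundle `V → M` with an anchor, that is, a smooth morphism of vector bundles
`ρ : V → TM` over the identity of `M`. -/
structure AnchoredBundle where
  anchor : ∀ x : M, V x →ₗ[ℝ] TangentSpace 𝓘(ℝ, E) x
  contMDiff_anchor :
    ContMDiff (𝓘(ℝ, E).prod 𝓘(ℝ, F)) 𝓘(ℝ, E).tangent ∞
      (fun p : Bundle.TotalSpace F V =>
        (⟨p.proj, anchor p.proj p.snd⟩ : TangentBundle 𝓘(ℝ, E) M))

variable {E F V}

/-- The action `ρ(X) f` of a smooth section `X` on a smooth function `f`: the derivative of `f`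
along the vector field `ρ(X)`. -/
def AnchoredBundle.act (A : AnchoredBundle E F V) (X : Cₛ^∞⟮𝓘(ℝ, E); F, V⟯)
    (f : C^∞⟮𝓘(ℝ, E), M; ℝ⟯) : C^∞⟮𝓘(ℝ, E), M; ℝ⟯ where
  val := fun x => mvfderiv 𝓘(ℝ, E) f x (A.anchor x (X x))
  property := by
    have h1 : ContMDiff 𝓘(ℝ, E) 𝓘(ℝ, E).tangent ∞
        (fun x => (⟨x, A.anchor x (X x)⟩ : TangentBundle 𝓘(ℝ, E) M)) :=
      A.contMDiff_anchor.comp X.contMDiff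
    have h2 := (f.contMDiff.contMDiff_tangentMap (m := ∞) le_rfl).comp h1
    exact (contMDiff_snd_tangentBundle_modelSpace ℝ 𝓘(ℝ, ℝ)).comp h2

/-- Multiplication of a smooth section by a smooth function. -/
def sectionSMul (f : C^∞⟮𝓘(ℝ, E), M; ℝ⟯) (X : Cₛ^∞⟮𝓘(ℝ, E); F, V⟯) :
    Cₛ^∞⟮𝓘(ℝ, E); F, V⟯ :=
  ⟨fun x => f x • X x, f.contMDiff.smul_section X.contMDiff⟩

variable (E F V)

/-- A Lie algebroid structure on the smooth vector bundle `V → M` with typical fibre `F`: an anchor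
`ρ : V → TM` and a Lie bracket on the smooth sections of `V`, such that
`[X, f Y] = f [X, Y] + (ρ(X) f) Y` and `ρ [X, Y] = [ρ X, ρ Y]`. -/
structure LieAlgebroid extends AnchoredBundle E F V where
  bracket : Cₛ^∞⟮𝓘(ℝ, E); F, V⟯ →ₗ[ℝ] Cₛ^∞⟮𝓘(ℝ, E); F, V⟯ →ₗ[ℝ] Cₛ^∞⟮𝓘(ℝ, E); F, V⟯
  bracket_self : ∀ X, bracket X X = 0
  jacobi : ∀ X Y Z,
    bracket X (bracket Y Z) = bracket (bracket X Y) Z + bracket Y (bracket X Z)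
  leibniz : ∀ (X Y : Cₛ^∞⟮𝓘(ℝ, E); F, V⟯) (f : C^∞⟮𝓘(ℝ, E), M; ℝ⟯),
    bracket X (sectionSMul f Y) =
      sectionSMul f (bracket X Y) + sectionSMul (toAnchoredBundle.act X f) Y
  anchor_bracket : ∀ (X Y : Cₛ^∞⟮𝓘(ℝ, E); F, V⟯) (f : C^∞⟮𝓘(ℝ, E), M; ℝ⟯),
    toAnchoredBundle.act (bracket X Y) f =
      toAnchoredBundle.act X (toAnchoredBundle.act Y f) -
        toAnchoredBundle.act Y (toAnchoredBundle.act X f)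

variable {E F V}

namespace LieAlgebroid

/-- The space `Γ(A)` of smooth sections of a Lie algebroid, with its structure of Lie–Rinehart
algebra over `C^∞(M)`: `⁅X, Y⁆` is the bracket of sections and `⁅X, f⁆ = ρ(X) f`. -/
def Sec (_A : LieAlgebroid E F V) : Type _ := Cₛ^∞⟮𝓘(ℝ, E); F, V⟯

variable (A : LieAlgebroid E F V)

instance : AddCommGroup A.Sec := inferInstanceAs (AddCommGroup Cₛ^∞⟮𝓘(ℝ, E); F, V⟯)

instance : LieRing A.Sec where
  bracket X Y := A.bracket X Y
  add_lie X Y Z := LinearMap.map_add₂ A.bracket X Y Z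
  lie_add X Y Z := map_add (A.bracket X) Y Z
  lie_self X := A.bracket_self X
  leibniz_lie X Y Z := A.jacobi X Y Z

instance : Module C^∞⟮𝓘(ℝ, E), M; ℝ⟯ A.Sec where
  smul f X := sectionSMul f X
  one_smul X := ContMDiffSection.ext fun x => one_smul ℝ (X.toFun x)
  mul_smul f g X := ContMDiffSection.ext fun x => mul_smul (f x) (g x) (X.toFun x)
  smul_zero f := ContMDiffSection.ext fun x => smul_zero (f x)
  smul_add f X Y := ContMDiffSection.ext fun x => smul_add (f x) (X.toFun x) (Y.toFun x)
  add_smul f g X := ContMDiffSection.ext fun x => add_smul (f x) (g x) (X.toFun x)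
  zero_smul X := ContMDiffSection.ext fun x => zero_smul ℝ (X.toFun x)

instance : LieRingModule A.Sec C^∞⟮𝓘(ℝ, E), M; ℝ⟯ where
  bracket X f := A.act X f
  add_lie X Y f := by
    ext x
    change mvfderiv 𝓘(ℝ, E) f x (A.anchor x (X.toFun x + Y.toFun x)) =
      mvfderiv 𝓘(ℝ, E) f x (A.anchor x (X.toFun x)) +
      mvfderiv 𝓘(ℝ, E) f x (A.anchor x (Y.toFun x))
    rw [map_add, map_add]
  lie_add X f g := by
    ext x
    change mvfderiv 𝓘(ℝ, E) (⇑f + ⇑g) x (A.anchor x (X.toFun x)) =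
      mvfderiv 𝓘(ℝ, E) f x (A.anchor x (X.toFun x)) +
      mvfderiv 𝓘(ℝ, E) g x (A.anchor x (X.toFun x))
    rw [mvfderiv_add f.mdifferentiableAt g.mdifferentiableAt]; rfl
  leibniz_lie X Y f := by
    have h := A.anchor_bracket X Y f
    change A.act X (A.act Y f) = A.act (A.bracket X Y) f + A.act Y (A.act X f)
    rw [h]; abel

instance : LieRinehartRing C^∞⟮𝓘(ℝ, E), M; ℝ⟯ A.Sec where
  lie_smul_eq_mul' f g X := by
    ext x
    change mvfderiv 𝓘(ℝ, E) g x (A.anchor x (f x • X.toFun x)) =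
      f x * mvfderiv 𝓘(ℝ, E) g x (A.anchor x (X.toFun x))
    rw [map_smul, map_smul]; rfl
  leibniz_mul_right' X f g := by
    ext x
    change mvfderiv 𝓘(ℝ, E) (⇑f * ⇑g) x (A.anchor x (X.toFun x)) =
      f x * mvfderiv 𝓘(ℝ, E) g x (A.anchor x (X.toFun x)) +
      mvfderiv 𝓘(ℝ, E) f x (A.anchor x (X.toFun x)) * g x
    rw [mvfderiv_mul f.mdifferentiableAt g.mdifferentiableAt]
    simp [mul_comm]
  leibniz_smul_right' X Y f := A.leibniz X Y f

end LieAlgebroid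

end Geometric

/-! ## Cartan calculus and generalized geometry

`R` stands for `C^∞(M)` and `L` for `Γ(A)`. Then `Γ(A*) = Module.Dual R L` (a `C^∞(M)`-linear form
on sections is the same as a smooth section of the dual bundle), and tensor fields are
`C^∞(M)`-multilinear maps. -/

namespace LieRinehart

open Module (Dual)

section Forms

variable (R L : Type*) [CommRing R] [AddCommGroup L] [Module R L]

/-- A `2`-form `Ω`, an alternating bilinear map on sections; `Ω.flat X = Ω(X, ·)`. -/
structure TwoForm where
  flat : L →ₗ[R] Dual R L
  alt : ∀ X, flat X X = 0

/-- A `3`-form, an alternating trilinear map on sections. -/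
structure ThreeForm where
  toMap : L →ₗ[R] L →ₗ[R] L →ₗ[R] R
  alt₁₂ : ∀ X Y, toMap X X Y = 0
  alt₂₃ : ∀ X Y, toMap X Y Y = 0

/-- A bivector `π`, given by the associated skew-symmetric map `π♯ : Γ(A*) → Γ(A)`,
`π♯ α = π(α, ·)`; thus `π(α, β) = β (π♯ α)`. -/
structure Bivector where
  sharp : Dual R L →ₗ[R] L
  alt : ∀ α : Dual R L, α (sharp α) = 0

variable {R L}

instance : Neg (TwoForm R L) := ⟨fun Ω => ⟨-Ω.flat, fun X => by simp [Ω.alt X]⟩⟩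

set_option maxSynthPendingDepth 3 in
instance : Neg (ThreeForm R L) :=
  ⟨fun H => ⟨-H.toMap, fun X Y => by simp [H.alt₁₂ X Y], fun X Y => by simp [H.alt₂₃ X Y]⟩⟩

theorem TwoForm.swap (Ω : TwoForm R L) (X Y : L) : Ω.flat X Y = -Ω.flat Y X := by
  have h := Ω.alt (X + Y)
  simp only [map_add, LinearMap.add_apply, Ω.alt, zero_add, add_zero] at h
  exact eq_neg_of_add_eq_zero_right h

/-- The `(1,1)`-tensor `N = π♯ ∘ Ω♭`. -/
def nTensor (P : Bivector R L) (Ω : TwoForm R L) : L →ₗ[R] L := P.sharp ∘ₗ Ω.flat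

/-- The `2`-form `Ω_N = Ω(N ·, ·)`, where `N = π♯ ∘ Ω♭`. -/
def omegaN (P : Bivector R L) (Ω : TwoForm R L) : TwoForm R L where
  flat := Ω.flat ∘ₗ nTensor P Ω
  alt X := by
    change Ω.flat (P.sharp (Ω.flat X)) X = 0
    rw [Ω.swap, P.alt, neg_zero]

/-- The endomorphism of `Γ(A ⊕ A*)` with block matrix `[[N, π♯], [σ♭, -ᵗN]]`. -/
def blockJ (N : L →ₗ[R] L) (P : Bivector R L) (σ : TwoForm R L) :
    (L × Dual R L) →ₗ[R] (L × Dual R L) where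
  toFun u := (N u.1 + P.sharp u.2, σ.flat u.1 - N.dualMap u.2)
  map_add' u v := by
    ext <;> simp <;> abel
  map_smul' f u := by
    ext <;> simp [mul_sub]

/-- The pairing `⟨X + α, Y + β⟩ = β(X) + α(Y)`. -/
def pairing (u v : L × Dual R L) : R := v.2 u.1 + u.2 v.1

/-- `J` is an almost c.p.s. structure: it is orthogonal and `J² = lam · id`, with
`lam ∈ {-1, 0, 1}`. -/
structure IsAlmostCPS (lam : ℤ) (J : (L × Dual R L) →ₗ[R] (L × Dual R L)) : Prop where
  lam_mem : lam = -1 ∨ lam = 0 ∨ lam = 1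
  orthogonal : ∀ u v, pairing (J u) v + pairing u (J v) = 0
  sq : ∀ u, J (J u) = lam • u

end Forms

variable {R L : Type*} [CommRing R] [LieRing L] [Module R L] [LieRingModule L R]
  [LieRinehartRing R L]

/-- The Lie derivative of a `1`-form, `(ℒ_X β)(Y) = ρ(X)(β(Y)) - β([X, Y])`. -/
def lieDer (X : L) (β : Dual R L) : Dual R L where
  toFun Y := ⁅X, β Y⁆ - β ⁅X, Y⁆
  map_add' Y Z := by simp only [map_add, lie_add]; abel
  map_smul' f Y := by
    simp only [map_smul, map_add, smul_eq_mul, LieRinehartRing.leibniz_mul_right,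
      LieRinehartRing.leibniz_smul_right, RingHom.id_apply]
    ring

/-- Brackets with a multiple in the first entry: `[f X, Y] = f [X, Y] - (ρ(Y) f) X`. -/
theorem smul_lie_eq (f : R) (X Y : L) : ⁅f • X, Y⁆ = f • ⁅X, Y⁆ - ⁅Y, f⁆ • X := by
  rw [← lie_skew, LieRinehartRing.leibniz_smul_right, ← lie_skew X Y, smul_neg]
  abel

/-- The differential of a `1`-form, `dα(X, Y) = ρ(X)(α(Y)) - ρ(Y)(α(X)) - α([X, Y])`. -/
def dOne (α : Dual R L) : TwoForm R L where
  flat := LinearMap.mk₂ R (fun X Y => ⁅X, α Y⁆ - ⁅Y, α X⁆ - α ⁅X, Y⁆)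
    (fun X X' Y => by simp only [map_add, lie_add, add_lie]; abel)
    (fun f X Y => by
      simp only [map_smul, map_sub, smul_eq_mul, smul_lie_eq, LieRinehartRing.lie_smul_eq_mul,
        LieRinehartRing.leibniz_mul_right]
      ring)
    (fun X Y Y' => by simp only [map_add, lie_add, add_lie]; abel)
    (fun f X Y => by
      simp only [map_smul, map_add, smul_eq_mul, LieRinehartRing.leibniz_smul_right,
        LieRinehartRing.lie_smul_eq_mul, LieRinehartRing.leibniz_mul_right]
      ring)
  alt X := by simp

/-- The differential of a `2`-form:
`dΩ(X, Y, Z) = ρ(X)(Ω(Y, Z)) - ρ(Y)(Ω(X, Z)) + ρ(Z)(Ω(X, Y))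
  - Ω([X, Y], Z) + Ω([X, Z], Y) - Ω([Y, Z], X)`. -/
def dTwo (Ω : TwoForm R L) : ThreeForm R L where
  toMap := LinearMap.mk₂ R
    (fun X Y =>
      { toFun := fun Z => ⁅X, Ω.flat Y Z⁆ - ⁅Y, Ω.flat X Z⁆ + ⁅Z, Ω.flat X Y⁆
          - Ω.flat ⁅X, Y⁆ Z + Ω.flat ⁅X, Z⁆ Y - Ω.flat ⁅Y, Z⁆ X
        map_add' := fun Z Z' => by
          simp only [map_add, lie_add, add_lie, LinearMap.add_apply]; abel
        map_smul' := fun f Z => by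
          simp only [map_smul, map_add, smul_eq_mul, LieRinehartRing.leibniz_smul_right,
            LieRinehartRing.lie_smul_eq_mul, LieRinehartRing.leibniz_mul_right,
            LinearMap.add_apply, LinearMap.smul_apply, RingHom.id_apply]
          rw [Ω.swap Z Y, Ω.swap Z X]
          ring })
    (fun X X' Y => by
      ext Z
      simp only [LinearMap.coe_mk, AddHom.coe_mk, map_add, lie_add, add_lie, LinearMap.add_apply]
      abel)
    (fun f X Y => by
      ext Z
      simp only [LinearMap.coe_mk, AddHom.coe_mk, map_smul, map_sub, smul_eq_mul, smul_lie_eq,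
        LieRinehartRing.lie_smul_eq_mul, LieRinehartRing.leibniz_mul_right,
        LinearMap.sub_apply, LinearMap.smul_apply]
      ring)
    (fun X Y Y' => by
      ext Z
      simp only [LinearMap.coe_mk, AddHom.coe_mk, map_add, lie_add, add_lie, LinearMap.add_apply]
      abel)
    (fun f X Y => by
      ext Z
      simp only [LinearMap.coe_mk, AddHom.coe_mk, map_smul, map_sub, map_add, smul_eq_mul,
        smul_lie_eq, LieRinehartRing.leibniz_smul_right, LieRinehartRing.lie_smul_eq_mul,
        LieRinehartRing.leibniz_mul_right, LinearMap.sub_apply, LinearMap.add_apply,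
        LinearMap.smul_apply]
      rw [Ω.swap Y X]
      ring)
  alt₁₂ X Y := by simp [Ω.alt]
  alt₂₃ X Y := by
    simp only [LinearMap.mk₂_apply, LinearMap.coe_mk, AddHom.coe_mk, Ω.alt, lie_zero, lie_self,
      map_zero, LinearMap.zero_apply]
    ring

/-- The differential of a `3`-form, evaluated on four sections. -/
def dThree (H : ThreeForm R L) (X Y Z W : L) : R :=
  ⁅X, H.toMap Y Z W⁆ - ⁅Y, H.toMap X Z W⁆ + ⁅Z, H.toMap X Y W⁆ - ⁅W, H.toMap X Y Z⁆
    - H.toMap ⁅X, Y⁆ Z W + H.toMap ⁅X, Z⁆ Y W - H.toMap ⁅X, W⁆ Y Z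
    - H.toMap ⁅Y, Z⁆ X W + H.toMap ⁅Y, W⁆ X Z - H.toMap ⁅Z, W⁆ X Y

/-- `dH = 0`; equivalently, `μ + H` is a Courant algebroid structure on `A ⊕ A*`. -/
def ThreeForm.IsClosed (H : ThreeForm R L) : Prop :=
  ∀ X Y Z W : L, dThree H X Y Z W = 0

/-- The Schouten–Nijenhuis bracket of two bivectors, evaluated on three `1`-forms. It is
biadditive, and on decomposable bivectors it is
`[X ∧ Y, Z ∧ W] = [X, Z] ∧ Y ∧ W - [X, W] ∧ Y ∧ Z - [Y, Z] ∧ X ∧ W + [Y, W] ∧ X ∧ Z`. -/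
def schouten (P Q : Bivector R L) (α β γ : Dual R L) : R :=
  lieDer (P.sharp α) β (Q.sharp γ) + lieDer (Q.sharp α) β (P.sharp γ)
    + lieDer (P.sharp β) γ (Q.sharp α) + lieDer (Q.sharp β) γ (P.sharp α)
    + lieDer (P.sharp γ) α (Q.sharp β) + lieDer (Q.sharp γ) α (P.sharp β)

/-- `π` is a Poisson bivector: `[π, π] = 0` for the Schouten–Nijenhuis bracket. -/
def Bivector.IsPoisson (P : Bivector R L) : Prop :=
  ∀ α β γ : Dual R L, schouten P P α β γ = 0

/-- The Dorfman bracket on `Γ(A ⊕ A*)` of the structure `μ + H`, i.e. the derived bracket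
`{{·, μ + H}, ·}`:
`[X + α, Y + β] = [X, Y] + ℒ_X β - i_Y dα - H(X, Y, ·)`.
The sign of the last term is that of `{{X, H}, Y} = -i_Y i_X H`, in the convention for the big
bracket in which `d = {μ, ·}` and `{X, α} = {α, X} = α(X)`. -/
def dorfman (H : ThreeForm R L) (u v : L × Dual R L) : L × Dual R L :=
  (⁅u.1, v.1⁆, lieDer u.1 v.2 - (dOne u.2).flat v.1 - H.toMap u.1 v.1)

/-- The deformed bracket `[u, v]_J = [J u, v] + [u, J v] - J [u, v]`. -/
def deformed (H : ThreeForm R L) (J : (L × Dual R L) →ₗ[R] (L × Dual R L))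
    (u v : L × Dual R L) : L × Dual R L :=
  dorfman H (J u) v + dorfman H u (J v) - J (dorfman H u v)

/-- The Nijenhuis torsion `T_J(u, v) = [J u, J v] - J [u, v]_J`. -/
def torsion (H : ThreeForm R L) (J : (L × Dual R L) →ₗ[R] (L × Dual R L))
    (u v : L × Dual R L) : L × Dual R L :=
  dorfman H (J u) (J v) - J (deformed H J u v)

/-- `J` is an (integrable) c.p.s. structure on `(A ⊕ A*, μ + H)`: an almost c.p.s. structure with
vanishing Nijenhuis torsion. -/
structure IsCPS (H : ThreeForm R L) (lam : ℤ) (J : (L × Dual R L) →ₗ[R] (L × Dual R L)) :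
    Prop extends IsAlmostCPS lam J where
  integrable : ∀ u v, torsion H J u v = 0

/-- A subtangent structure is a c.p.s. structure with `lam = 0`. -/
def IsSubtangent (H : ThreeForm R L) (J : (L × Dual R L) →ₗ[R] (L × Dual R L)) : Prop :=
  IsCPS H 0 J

end LieRinehart

end

namespace LieRinehart

open Module (Dual)

section Algebraic

variable {R L : Type*} [CommRing R]

section Linear

variable [AddCommGroup L] [Module R L]

/-! Everything is a gauge transform of the case `Ω = 0`. Let `e^Ω` denote the orthogonal shear `X +
α ↦ X + α + Ω♭ X`. Then `J = e^{-Ω} ∘ π ∘ e^Ω`, where `π` is the endomorphism `X + α ↦ π♯ α`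
(`blockJ_eq_gauge_conj`), and `e^Ω` carries the bracket of `μ - dΩ` to that of `μ`
(`dorfman_neg_dTwo`).

So orthogonality and `J² = 0` follow from the skewness of `π` and `π² = 0`, and the torsion of `J`
is the gauge image of the torsion of `π` for the untwisted bracket. The latter vanishes exactly when
`π♯` sends the Koszul bracket of `1`-forms to the bracket of sections (`lie_sharp`), which `[π, π] =
0` gives after pairing with an arbitrary `1`-form. That pairing loses nothing because bump functions
make `1`-forms separate sections. -/

theorem Bivector.swap (P : Bivector R L) (α β : Dual R L) :
    α (P.sharp β) = -β (P.sharp α) := by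
  have h := P.alt (α + β)
  simp only [map_add, LinearMap.add_apply, P.alt, zero_add, add_zero] at h
  exact eq_neg_of_add_eq_zero_right h

/-! ### Gauge transformations and the almost structure -/

/-- The gauge transformation `X + α ↦ X + (α + Ω♭ X)`. -/
def gauge (Ω : TwoForm R L) : (L × Dual R L) →ₗ[R] (L × Dual R L) where
  toFun u := (u.1, u.2 + Ω.flat u.1)
  map_add' u v := by ext <;> simp; abel
  map_smul' f u := by ext <;> simp

@[simp] theorem gauge_apply (Ω : TwoForm R L) (u : L × Dual R L) :
    gauge Ω u = (u.1, u.2 + Ω.flat u.1) := rfl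

instance : Zero (ThreeForm R L) := ⟨⟨0, fun _ _ => rfl, fun _ _ => rfl⟩⟩

theorem zero_toMap : (0 : ThreeForm R L).toMap = 0 := rfl

theorem neg_toMap_apply (H : ThreeForm R L) (X Y Z : L) :
    (-H).toMap X Y Z = -H.toMap X Y Z := rfl

theorem neg_flat (Ω : TwoForm R L) : (-Ω).flat = -Ω.flat := rfl

theorem gauge_gauge_neg (Ω : TwoForm R L) (u : L × Dual R L) :
    gauge Ω (gauge (-Ω) u) = u := by
  simp [neg_flat]

/-- A bivector as the endomorphism `X + α ↦ π♯ α` of `Γ(A ⊕ A*)`. -/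
def Bivector.endo (P : Bivector R L) : (L × Dual R L) →ₗ[R] (L × Dual R L) :=
  LinearMap.inl R L (Dual R L) ∘ₗ P.sharp ∘ₗ LinearMap.snd R L (Dual R L)

@[simp] theorem Bivector.endo_apply (P : Bivector R L) (u : L × Dual R L) :
    P.endo u = (P.sharp u.2, 0) := rfl

theorem pairing_gauge (Ω : TwoForm R L) (u v : L × Dual R L) :
    pairing (gauge Ω u) (gauge Ω v) = pairing u v := by
  simp only [pairing, gauge_apply, LinearMap.add_apply]
  rw [Ω.swap v.1 u.1]
  ring

/-- The lower blocks come from `-Ω♭ π♯ Ω♭ = -Ω_N♭` and `Ω♭ π♯ = ᵗN`; the latter uses the skewness of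
both `π` and `Ω`. -/
theorem blockJ_eq_gauge_conj (P : Bivector R L) (Ω : TwoForm R L) (u : L × Dual R L) :
    blockJ (nTensor P Ω) P (-omegaN P Ω) u = gauge (-Ω) (P.endo (gauge Ω u)) := by
  refine Prod.ext ?_ (LinearMap.ext fun Y => ?_)
  · simp [blockJ, nTensor, add_comm]
  · have h : u.2 (P.sharp (Ω.flat Y)) = Ω.flat (P.sharp u.2) Y := by
      rw [P.swap, Ω.swap (P.sharp u.2) Y]
    simp [blockJ, nTensor, omegaN, neg_flat, h]
    ring

theorem isAlmostCPS_blockJ (P : Bivector R L) (Ω : TwoForm R L) :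
    IsAlmostCPS 0 (blockJ (nTensor P Ω) P (-omegaN P Ω)) where
  lam_mem := Or.inr (Or.inl rfl)
  orthogonal u v := by
    -- Applying `e^Ω` to both arguments cancels the outer `e^{-Ω}` of `J`, leaving the skewness of
    -- `π♯`.
    rw [← pairing_gauge Ω, ← pairing_gauge Ω u]
    simp only [blockJ_eq_gauge_conj, gauge_gauge_neg]
    simp only [pairing, Bivector.endo_apply, LinearMap.zero_apply, zero_add, add_zero]
    rw [P.swap, neg_add_cancel]
  sq u := by
    simp only [blockJ_eq_gauge_conj, gauge_gauge_neg]
    simp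

end Linear

variable [LieRing L] [Module R L] [LieRingModule L R] [LieRinehartRing R L]

/-! ### Twisted Dorfman brackets and torsion -/

theorem lieDer_apply (X : L) (β : Dual R L) (Y : L) :
    lieDer X β Y = ⁅X, β Y⁆ - β ⁅X, Y⁆ := rfl

theorem dOne_flat_apply (α : Dual R L) (X Y : L) :
    (dOne α).flat X Y = ⁅X, α Y⁆ - ⁅Y, α X⁆ - α ⁅X, Y⁆ := rfl

@[simp] theorem lieDer_zero (X : L) : lieDer X (0 : Dual R L) = 0 :=
  LinearMap.ext fun Y => by simp [lieDer_apply]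

theorem dOne_zero_flat : (dOne (0 : Dual R L)).flat = 0 :=
  LinearMap.ext fun X => LinearMap.ext fun Y => by simp [dOne_flat_apply]

theorem dTwo_apply (Ω : TwoForm R L) (X Y Z : L) :
    (dTwo Ω).toMap X Y Z = ⁅X, Ω.flat Y Z⁆ - ⁅Y, Ω.flat X Z⁆ + ⁅Z, Ω.flat X Y⁆
      - Ω.flat ⁅X, Y⁆ Z + Ω.flat ⁅X, Z⁆ Y - Ω.flat ⁅Y, Z⁆ X := rfl

/-- `d ∘ d = 0` on `2`-forms. -/
theorem dThree_neg_dTwo (Ω : TwoForm R L) (X Y Z W : L) :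
    dThree (-dTwo Ω) X Y Z W = 0 := by
  simp only [dThree, neg_toMap_apply, dTwo_apply]
  simp only [lie_add, lie_sub, lie_neg, lie_lie, map_sub, LinearMap.sub_apply]
  rw [Ω.swap ⁅Z, W⁆ ⁅X, Y⁆, Ω.swap ⁅Y, W⁆ ⁅X, Z⁆, Ω.swap ⁅Y, Z⁆ ⁅X, W⁆]
  rw [← lie_skew Z X, ← lie_skew Z Y, ← lie_skew Y X, ← lie_skew W X, ← lie_skew W Y,
    ← lie_skew W Z]
  -- Once inner brackets are ordered, Jacobi removes one of the three nested brackets of each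
  -- triple, and the remaining terms cancel.
  have jac (X Y Z : L) : ⁅Z, ⁅X, Y⁆⁆ = ⁅Y, ⁅X, Z⁆⁆ - ⁅X, ⁅Y, Z⁆⁆ := by
    rw [← lie_skew, lie_lie, neg_sub]
  simp only [lie_neg, map_neg, LinearMap.neg_apply]
  rw [jac X Y Z, jac X Y W, jac X Z W, jac Y Z W]
  simp only [map_sub, LinearMap.sub_apply]
  abel

/-- The gauge transformation by `Ω` intertwines the Dorfman brackets of `μ - dΩ` and `μ`. -/
theorem dorfman_neg_dTwo (Ω : TwoForm R L) (u v : L × Dual R L) :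
    dorfman (-dTwo Ω) u v = gauge (-Ω) (dorfman 0 (gauge Ω u) (gauge Ω v)) := by
  -- The content is `ℒ_X (Ω♭ Y) - i_Y d(Ω♭ X) = Ω♭ [X, Y] + dΩ(X, Y, ·)`: `e^{-Ω}` removes the first
  -- term, and the second is `-H` for `H = -dΩ`.
  refine Prod.ext rfl (LinearMap.ext fun Z => ?_)
  simp only [dorfman, gauge_apply, neg_flat, zero_toMap, LinearMap.add_apply, LinearMap.sub_apply,
    LinearMap.neg_apply, LinearMap.zero_apply, neg_toMap_apply, dTwo_apply, lieDer_apply,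
    dOne_flat_apply, lie_add]
  rw [Ω.swap ⁅u.1, Z⁆ v.1, Ω.swap ⁅v.1, Z⁆ u.1]
  abel

/-- The Koszul bracket of `1`-forms is mapped by `π♯` to the bracket of sections, provided that `π`
is Poisson, that `1`-forms separate sections and that `R` has no `2`-torsion. -/
theorem Bivector.IsPoisson.lie_sharp {P : Bivector R L} (hP : P.IsPoisson)
    (h2 : ∀ f : R, f + f = 0 → f = 0) (hsep : ∀ X : L, (∀ γ : Dual R L, γ X = 0) → X = 0)
    (α β : Dual R L) :
    ⁅P.sharp α, P.sharp β⁆ =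
      P.sharp (lieDer (P.sharp α) β - (dOne α).flat (P.sharp β)) := by
  rw [← sub_eq_zero]
  -- The defect is paired with `γ` and doubled, because the two equal arguments make `schouten P P`
  -- count each term twice.
  refine hsep _ fun γ => h2 _ ?_
  have h := hP α β γ
  simp only [schouten, lieDer_apply] at h
  rw [map_sub, P.swap γ, LinearMap.sub_apply, lieDer_apply, dOne_flat_apply]
  rw [P.swap γ α, ← lie_skew (P.sharp α) (P.sharp β), ← lie_skew (P.sharp β) (P.sharp γ)] at *
  simp only [lie_neg, map_neg] at h ⊢
  linear_combination h

theorem isSubtangent_blockJ {P : Bivector R L} (hP : P.IsPoisson)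
    (h2 : ∀ f : R, f + f = 0 → f = 0) (hsep : ∀ X : L, (∀ γ : Dual R L, γ X = 0) → X = 0)
    (Ω : TwoForm R L) :
    IsSubtangent (-dTwo Ω) (blockJ (nTensor P Ω) P (-omegaN P Ω)) where
  toIsAlmostCPS := isAlmostCPS_blockJ P Ω
  integrable u v := by
    simp only [torsion, deformed, blockJ_eq_gauge_conj, dorfman_neg_dTwo, map_add, map_sub,
      gauge_gauge_neg]
    -- The torsion is now `e^{-Ω}` of the untwisted torsion of `π` at `e^Ω u`, `e^Ω v`, which may be
    -- treated as arbitrary.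
    simp only [← map_add, ← map_sub]
    generalize gauge Ω u = u
    generalize gauge Ω v = v
    convert map_zero (gauge (-Ω))
    refine Prod.ext ?_ ?_ <;>
      simp [dorfman, hP.lie_sharp h2 hsep, zero_toMap, dOne_zero_flat, sub_eq_add_neg]

end Algebraic
end LieRinehart

/-! ### Geometric input -/

open Bundle in
/-- `1`-forms separate the sections of a Lie algebroid. -/
theorem LieAlgebroid.eq_zero_of_forall_dual
    {E : Type*} [NormedAddCommGroup E] [NormedSpace ℝ E] [FiniteDimensional ℝ E]
    {M : Type*} [TopologicalSpace M] [T2Space M]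
    [ChartedSpace E M] [IsManifold 𝓘(ℝ, E) ∞ M]
    {F : Type*} [NormedAddCommGroup F] [NormedSpace ℝ F]
    {V : M → Type*} [TopologicalSpace (TotalSpace F V)]
    [∀ x, TopologicalSpace (V x)] [∀ x, AddCommGroup (V x)] [∀ x, Module ℝ (V x)]
    [FiberBundle F V] [VectorBundle ℝ F V] [ContMDiffVectorBundle ∞ F V 𝓘(ℝ, E)]
    (A : LieAlgebroid E F V) (X : A.Sec)
    (hX : ∀ γ : Module.Dual C^∞⟮𝓘(ℝ, E), M; ℝ⟯ A.Sec, γ X = 0) : X = 0 := by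
  refine ContMDiffSection.ext fun x => ?_
  change X.toFun x = 0
  let e := trivializationAt F V x
  have hx : x ∈ e.baseSet := FiberBundle.mem_baseSet_trivializationAt' x
  -- The closed support of `χ` lies in the trivializing domain, so the local form `χ · (ℓ ∘ e)`
  -- extends by zero to a smooth global `1`-form; its value at `x` is `ℓ ∘ e` since `χ x = 1`.
  obtain ⟨χ, hχ, -⟩ := (SmoothBumpFunction.nhds_basis_support (I := 𝓘(ℝ, E))
    (e.open_baseSet.mem_nhds hx)).mem_iff.1 (e.open_baseSet.mem_nhds hx)
  have key (ℓ : F →L[ℝ] ℝ) : ℓ (e.linearMapAt ℝ x (X.toFun x)) = 0 := by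
    have hsm (Y : A.Sec) : ContMDiff 𝓘(ℝ, E) 𝓘(ℝ, ℝ) ∞
        (fun y => χ y • ℓ (e.linearMapAt ℝ y (Y.toFun y))) := by
      refine contMDiff_of_tsupport fun y hy => ?_
      have hy' : y ∈ e.baseSet := hχ (tsupport_smul_subset_left _ _ hy)
      refine χ.contMDiffAt.smul (ℓ.contMDiff.contMDiffAt.comp y ?_)
      refine ((e.contMDiffAt_section_iff hy').1 (Y.contMDiff_toFun y)).congr_of_eventuallyEq ?_
      filter_upwards [e.open_baseSet.mem_nhds hy'] with z hz
      rw [e.coe_linearMapAt_of_mem hz]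
    let γ : Module.Dual C^∞⟮𝓘(ℝ, E), M; ℝ⟯ A.Sec :=
      { toFun Y := ⟨_, hsm Y⟩
        map_add' Y Z := by
          ext y
          change χ y • ℓ (e.linearMapAt ℝ y (Y.toFun y + Z.toFun y)) =
            χ y • ℓ (e.linearMapAt ℝ y (Y.toFun y)) + χ y • ℓ (e.linearMapAt ℝ y (Z.toFun y))
          rw [map_add, map_add, smul_add]
        map_smul' f Y := by
          ext y
          change χ y • ℓ (e.linearMapAt ℝ y (f y • Y.toFun y)) =
            f y • χ y • ℓ (e.linearMapAt ℝ y (Y.toFun y))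
          rw [map_smul, map_smul, smul_comm] }
    have h : χ x • ℓ (e.linearMapAt ℝ x (X.toFun x)) = 0 :=
      congrArg (fun f : C^∞⟮𝓘(ℝ, E), M; ℝ⟯ => f x) (hX γ)
    rwa [χ.eq_one, one_smul] at h
  have h0 : e.linearMapAt ℝ x (X.toFun x) = 0 :=
    SeparatingDual.eq_zero_of_forall_dual_eq_zero (R := ℝ) key
  rw [← e.symmₗ_linearMapAt (R := ℝ) hx (X.toFun x), h0, map_zero]

theorem mainTheorem7
    {E : Type*} [NormedAddCommGroup E] [NormedSpace ℝ E] [FiniteDimensional ℝ E]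
    {M : Type*} [TopologicalSpace M] [T2Space M] [SecondCountableTopology M]
    [ChartedSpace E M] [IsManifold 𝓘(ℝ, E) ∞ M]
    {F : Type*} [NormedAddCommGroup F] [NormedSpace ℝ F] [FiniteDimensional ℝ F]
    {V : M → Type*} [TopologicalSpace (Bundle.TotalSpace F V)]
    [∀ x, TopologicalSpace (V x)] [∀ x, AddCommGroup (V x)] [∀ x, Module ℝ (V x)]
    [FiberBundle F V] [VectorBundle ℝ F V] [ContMDiffVectorBundle ∞ F V 𝓘(ℝ, E)]
    (A : LieAlgebroid E F V)
    (P : LieRinehart.Bivector C^∞⟮𝓘(ℝ, E), M; ℝ⟯ A.Sec) (hP : P.IsPoisson)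
    (Ω : LieRinehart.TwoForm C^∞⟮𝓘(ℝ, E), M; ℝ⟯ A.Sec) :
    (-LieRinehart.dTwo Ω).IsClosed ∧
      LieRinehart.IsSubtangent (-LieRinehart.dTwo Ω)
        (LieRinehart.blockJ (LieRinehart.nTensor P Ω) P (-LieRinehart.omegaN P Ω)) := by
  refine ⟨LieRinehart.dThree_neg_dTwo Ω, LieRinehart.isSubtangent_blockJ hP (fun f hf => ?_)
    A.eq_zero_of_forall_dual Ω⟩
  -- `C^∞(M)` has no `2`-torsion, as seen pointwise in `ℝ`.
  ext x
  have h : f x + f x = 0 := congrArg (fun g : C^∞⟮𝓘(ℝ, E), M; ℝ⟯ => g x) hf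
  exact add_self_eq_zero.1 h
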